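/- Theorem. Let $S$ and $T$ be commutative Noetherian local rings with a common residue field $k$, with surjective ring homomorphisms $\pi_S : S\to k$ and $\pi_T : T\to k$, and assume that neither $S$ nor $T$ is a field. Let $$R = S\times_k T = \{(s,t)\in S\times T \mid \pi_S(s)=\pi_T(t)\}$$ be their fiber product, and let $M$ and $N$ be finitely generated $R$-modules. Suppose that neither $S$ nor $T$ is a discrete valuation ring, and that $\operatorname{Tor}^R_m(M,N)=0$ for some integer $m\ge 6$. Then $\operatorname{pd}_R M\le 1$ or $\operatorname{pd}_R N\le 1$. Consequently $\operatorname{Tor}^R_i(M,N)=0$ for all $i\ge 2$. -/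

import Mathlib

universe u v w

open CategoryTheory CategoryTheory.Limits

/-- A commutative ring is a DVR if it is an integral domain and, as such, a discrete valuation
ring (Mathlib's `IsDiscreteValuationRing` is only stated for domains). -/
def IsDVR (A : Type*) [CommRing A] : Prop :=
  ∃ _ : IsDomain A, IsDiscreteValuationRing A

/-! The maximal ideal of `R` is `I ⊕ J` with `I = ker (R → T) ≅ 𝔪_S` and `J = ker (R → S) ≅ 𝔪_T`.
Both are nonzero because `S` and `T` are not fields, and `I * J = 0`.

This splitting passes to syzygies: a minimal syzygy `K` of a submodule of `R^n` is `(K ∩ I^r) ⊕ (K ∩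
J^r)` (`exists_retraction`). A nonzero finite module killed by `J` has `J` as a direct summand of
its minimal syzygy (`torVanishes_of_smul_eq_zero`), and symmetrically for `I`. If `pd M > 1`, the
second syzygy of `M` is nonzero, so vanishing of `Tor_m(M, N)` gives vanishing of `Tor_{m-3}(I, N)`
or `Tor_{m-3}(J, N)`.

Each further syzygy exchanges `I` and `J` and lowers the degree by one. Since `S` and `T` are not
DVRs, one can also change ideal in two steps (`notFreeModuloComplement`, `torVanishes_swap_twice`),
so parity is no obstruction and `Tor_1` vanishes for both `I` and `J`. Hence `Tor_1(𝔪, N) = 0`, that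
is `Tor_2(k, N) = 0`, and `pd N ≤ 1`. -/

/-- `Tor_n^R(A, N) = 0`. -/
abbrev TorVanishes (R : Type u) [CommRing R] (n : ℕ) (A N : Type u) [AddCommGroup A] [Module R A]
    [AddCommGroup N] [Module R N] : Prop :=
  IsZero (((Tor (ModuleCat.{u} R) n).obj (ModuleCat.of R A)).obj (ModuleCat.of R N))

/-! ### Tor: dimension shifting, degree one, retracts -/

section TorInterface

open MonoidalCategory

variable {R : Type u} [CommRing R]

/-- Tensoring a short complex of modules with a chain complex of modules. -/
noncomputable abbrev tensorShortComplex (S : ShortComplex (ModuleCat.{u} R))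
    (K : ChainComplex (ModuleCat.{u} R) ℕ) :
    ShortComplex (ChainComplex (ModuleCat.{u} R) ℕ) where
  X₁ := (((tensoringLeft (ModuleCat.{u} R)).obj S.X₁).mapHomologicalComplex _).obj K
  X₂ := (((tensoringLeft (ModuleCat.{u} R)).obj S.X₂).mapHomologicalComplex _).obj K
  X₃ := (((tensoringLeft (ModuleCat.{u} R)).obj S.X₃).mapHomologicalComplex _).obj K
  f := (NatTrans.mapHomologicalComplex ((tensoringLeft (ModuleCat.{u} R)).map S.f) _).app K
  g := (NatTrans.mapHomologicalComplex ((tensoringLeft (ModuleCat.{u} R)).map S.g) _).app K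
  zero := by
    ext i : 1
    change S.f ▷ K.X i ≫ S.g ▷ K.X i = 0
    rw [← comp_whiskerRight, S.zero]
    simp

lemma tensorShortComplex_shortExact {S : ShortComplex (ModuleCat.{u} R)} (hS : S.ShortExact)
    (K : ChainComplex (ModuleCat.{u} R) ℕ) [∀ i, Module.Flat R (K.X i)] :
    (tensorShortComplex S K).ShortExact := by
  apply HomologicalComplex.shortExact_of_degreewise_shortExact
  intro i
  have := hS.mono_f
  have := hS.epi_g
  have : Mono ((tensorRight (K.X i)).map S.f) := inferInstance
  exact hS.map (tensorRight (K.X i))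

lemma exactAt_tensor_of_flat (F : ModuleCat.{u} R) [Module.Flat R F]
    {K : ChainComplex (ModuleCat.{u} R) ℕ} {i : ℕ} (hK : K.ExactAt i) :
    ((((tensoringLeft (ModuleCat.{u} R)).obj F).mapHomologicalComplex _).obj K).ExactAt i :=
  Module.Flat.lTensor_shortComplex_exact F (K.sc i) hK

variable {A F C N : Type u} [AddCommGroup A] [Module R A] [AddCommGroup F] [Module R F]
  [AddCommGroup C] [Module R C] [AddCommGroup N] [Module R N]

/-- `Tor` is derived in its second variable, so `N` is the module resolved; exact sequences in the
first variable come from tensoring them with this resolution. -/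
lemma torVanishes_iff_homology (n : ℕ) (P : ProjectiveResolution (ModuleCat.of R N)) :
    TorVanishes R n A N ↔ IsZero (((((tensoringLeft (ModuleCat.{u} R)).obj
      (ModuleCat.of R A)).mapHomologicalComplex _).obj P.complex).homology n) :=
  (P.isoLeftDerivedObj ((tensoringLeft (ModuleCat.{u} R)).obj (ModuleCat.of R A)) n).isZero_iff

lemma flat_of_projectiveResolution {Z : ModuleCat.{u} R} (P : ProjectiveResolution Z) (i : ℕ) :
    Module.Flat R (P.complex.X i) := by
  have : Module.Projective R (P.complex.X i) :=
    (IsProjective.iff_projective (R := R) (P.complex.X i)).mpr (P.projective i)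
  infer_instance

lemma torVanishes_succ_of_flat (n : ℕ) [Module.Flat R F] : TorVanishes R (n + 1) F N := by
  rw [torVanishes_iff_homology _ (projectiveResolution _)]
  exact (exactAt_tensor_of_flat (ModuleCat.of R F)
    ((projectiveResolution (ModuleCat.of R N)).complex_exactAt_succ n)).isZero_homology

variable {f : A →ₗ[R] F} {g : F →ₗ[R] C}

/-- Dimension shift in the first variable. -/
lemma torVanishes_add_two_iff [Module.Flat R F] (hf : Function.Injective f)
    (hfg : Function.Exact f g) (hg : Function.Surjective g) (n : ℕ) :
    TorVanishes R (n + 2) C N ↔ TorVanishes R (n + 1) A N := by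
  let P := projectiveResolution (ModuleCat.of R N)
  have hP := flat_of_projectiveResolution P
  let S := ModuleCat.shortComplexOfCompEqZero f g hfg.linearMap_comp_eq_zero
  have hS : S.ShortExact := ModuleCat.shortComplex_shortExact S hfg hf hg
  have h := tensorShortComplex_shortExact hS P.complex
  rw [torVanishes_iff_homology _ P, torVanishes_iff_homology _ P]
  exact (h.δIso (n + 2) (n + 1) rfl
    ((torVanishes_iff_homology _ P).1 (torVanishes_succ_of_flat (F := F) (N := N) (n + 1)))
    ((torVanishes_iff_homology _ P).1 (torVanishes_succ_of_flat (F := F) (N := N) n))).isZero_iff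

lemma opcyclesMap_comp_fromLeftDerivedZero' {X : ModuleCat.{u} R} (P : ProjectiveResolution X)
    {G H : ModuleCat.{u} R ⥤ ModuleCat.{u} R} [G.Additive] [H.Additive] (α : G ⟶ H) :
    HomologicalComplex.opcyclesMap ((NatTrans.mapHomologicalComplex α _).app P.complex) 0 ≫
      P.fromLeftDerivedZero' H = P.fromLeftDerivedZero' G ≫ α.app X := by
  rw [← cancel_epi (HomologicalComplex.pOpcycles _ _), HomologicalComplex.p_opcyclesMap_assoc,
    ProjectiveResolution.pOpcycles_comp_fromLeftDerivedZero',
    ProjectiveResolution.pOpcycles_comp_fromLeftDerivedZero'_assoc]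
  exact (α.naturality _).symm

/-- For right exact functors the zeroth derived functor is the functor itself, naturally. -/
lemma mono_homologyMap_zero_iff {X : ModuleCat.{u} R} (P : ProjectiveResolution X)
    {G H : ModuleCat.{u} R ⥤ ModuleCat.{u} R} [G.Additive] [H.Additive]
    [PreservesFiniteColimits G] [PreservesFiniteColimits H] (α : G ⟶ H) :
    Mono (HomologicalComplex.homologyMap
      ((NatTrans.mapHomologicalComplex α _).app P.complex) 0) ↔ Mono (α.app X) := by
  refine (MorphismProperty.monomorphisms _).arrow_mk_iso_iff (Arrow.isoMk
    (ChainComplex.isoHomologyι₀ _ ≪≫ asIso (P.fromLeftDerivedZero' G))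
    (ChainComplex.isoHomologyι₀ _ ≪≫ asIso (P.fromLeftDerivedZero' H)) ?_)
  dsimp
  rw [Category.assoc, ← opcyclesMap_comp_fromLeftDerivedZero' P α]
  exact (HomologicalComplex.homologyι_naturality_assoc _ _ _).symm

lemma mono_homologyMap_rTensor_iff (P : ProjectiveResolution (ModuleCat.of R N)) :
    Mono (HomologicalComplex.homologyMap ((NatTrans.mapHomologicalComplex
      ((tensoringLeft (ModuleCat.{u} R)).map (ModuleCat.ofHom f)) _).app P.complex) 0) ↔
      Function.Injective (f.rTensor N) := by
  have : PreservesFiniteColimits ((tensoringLeft (ModuleCat.{u} R)).obj (ModuleCat.of R A)) :=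
    inferInstanceAs (PreservesFiniteColimits (tensorLeft (ModuleCat.of R A)))
  have : PreservesFiniteColimits ((tensoringLeft (ModuleCat.{u} R)).obj (ModuleCat.of R F)) :=
    inferInstanceAs (PreservesFiniteColimits (tensorLeft (ModuleCat.of R F)))
  rw [mono_homologyMap_zero_iff P, ModuleCat.mono_iff_injective]
  rfl

/-- Since `Tor_1(F, N) = 0`, the connecting map identifies `Tor_1(C, N)` with the kernel of `A ⊗ N →
F ⊗ N`. -/
lemma torVanishes_one_iff [Module.Flat R F] (hf : Function.Injective f)
    (hfg : Function.Exact f g) (hg : Function.Surjective g) :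
    TorVanishes R 1 C N ↔ Function.Injective (f.rTensor N) := by
  let P := projectiveResolution (ModuleCat.of R N)
  have hP := flat_of_projectiveResolution P
  let S := ModuleCat.shortComplexOfCompEqZero f g hfg.linearMap_comp_eq_zero
  have hS : S.ShortExact := ModuleCat.shortComplex_shortExact S hfg hf hg
  have h := tensorShortComplex_shortExact hS P.complex
  have hrel : (ComplexShape.down ℕ).Rel 1 0 := rfl
  have h1 := h.homology_exact₁ 1 0 hrel
  have h2 : Mono (h.δ 1 0 hrel) := h.mono_δ 1 0 hrel
    ((torVanishes_iff_homology _ P).1 (torVanishes_succ_of_flat (F := F) (N := N) 0))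
  rw [torVanishes_iff_homology _ P, ← mono_homologyMap_rTensor_iff P]
  refine ⟨fun h0 => h1.mono_g (h0.eq_of_src _ _), fun h0 => ?_⟩
  have : h.δ 1 0 hrel = 0 := by
    rw [← cancel_mono (HomologicalComplex.homologyMap (tensorShortComplex S P.complex).f 0), h.δ_comp,
      zero_comp]
  exact IsZero.of_mono_eq_zero _ this

lemma TorVanishes.of_retract {n : ℕ} (h : TorVanishes R n F N) (i : A →ₗ[R] F) (r : F →ₗ[R] A)
    (hir : r ∘ₗ i = LinearMap.id) : TorVanishes R n A N := by
  have e : ModuleCat.ofHom i ≫ ModuleCat.ofHom r = 𝟙 (ModuleCat.of R A) := by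
    rw [← ModuleCat.ofHom_comp, hir]; rfl
  have hm : ((Tor (ModuleCat.{u} R) n).map (ModuleCat.ofHom i)).app (ModuleCat.of R N) ≫
      ((Tor (ModuleCat.{u} R) n).map (ModuleCat.ofHom r)).app (ModuleCat.of R N) = 𝟙 _ := by
    rw [← NatTrans.comp_app, ← Functor.map_comp, e, CategoryTheory.Functor.map_id]; rfl
  rw [TorVanishes, IsZero.iff_id_eq_zero, ← hm, h.eq_of_tgt
    (((Tor (ModuleCat.{u} R) n).map (ModuleCat.ofHom i)).app (ModuleCat.of R N)) 0, zero_comp]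

end TorInterface

/-! ### Projective dimension at most one and vanishing of Tor -/

section ProjectiveDimensionOne

open TensorProduct

variable {R : Type u} [CommRing R] {A F C N : Type u} [AddCommGroup A] [Module R A]
  [AddCommGroup F] [Module R F] [AddCommGroup C] [Module R C] [AddCommGroup N] [Module R N]

lemma projectiveDimension_le_one_iff_projective [Module.Projective R F] {f : A →ₗ[R] F}
    {g : F →ₗ[R] C} (hf : Function.Injective f) (hfg : Function.Exact f g)
    (hg : Function.Surjective g) :
    projectiveDimension (ModuleCat.of R C) ≤ 1 ↔ Module.Projective R A := by
  let S := ModuleCat.shortComplexOfCompEqZero f g hfg.linearMap_comp_eq_zero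
  have hS : S.ShortExact := ModuleCat.shortComplex_shortExact S hfg hf hg
  have h2 : Projective S.X₂ := (IsProjective.iff_projective F).1 inferInstance
  rw [IsProjective.iff_projective, projective_iff_hasProjectiveDimensionLT_one]
  exact (projectiveDimension_le_iff _ 1).trans (hS.hasProjectiveDimensionLT_X₃_iff 0 h2)

lemma exists_finsupp_cover (R : Type u) [CommRing R] (C : Type v) [AddCommGroup C] [Module R C] :
    ∃ g : (C →₀ R) →ₗ[R] C, Function.Surjective g :=
  ⟨Finsupp.linearCombination R id, Finsupp.linearCombination_id_surjective R C⟩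

lemma torVanishes_add_two_of_left (n : ℕ)
    (h : projectiveDimension (ModuleCat.of R C) ≤ 1) : TorVanishes R (n + 2) C N := by
  obtain ⟨g, hg⟩ := exists_finsupp_cover R C
  have hex : Function.Exact (LinearMap.ker g).subtype g := g.exact_subtype_ker_map
  rw [torVanishes_add_two_iff (Submodule.subtype_injective _) hex hg]
  have := (projectiveDimension_le_one_iff_projective (Submodule.subtype_injective _) hex hg).1 h
  exact torVanishes_succ_of_flat n

/-- `Tor_1` vanishes on submodules of flat modules when the second variable has a flat syzygy. -/
lemma torVanishes_one_of_flat_syzygy {K G N₁ N₂ : Type u} [AddCommGroup K] [Module R K]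
    [AddCommGroup G] [Module R G] [AddCommGroup N₁] [Module R N₁] [AddCommGroup N₂] [Module R N₂]
    [Module.Flat R F] [Module.Flat R G] [Module.Flat R N₁] [Module.Flat R N₂]
    {f : A →ₗ[R] F} (hf : Function.Injective f) {k : K →ₗ[R] G} {g : G →ₗ[R] A}
    (hk : Function.Injective k) (hkg : Function.Exact k g) (hg : Function.Surjective g)
    {i : N₁ →ₗ[R] N₂} {q : N₂ →ₗ[R] N} (hi : Function.Injective i) (hiq : Function.Exact i q)
    (hq : Function.Surjective q) : TorVanishes R 1 A N := by
  refine (torVanishes_one_iff hk hkg hg).2 ?_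
  rw [← LinearMap.lTensor_inj_iff_rTensor_inj]
  refine lTensor_injective_of_exact_of_exact_of_rTensor_injective hiq hq hkg hg ?_
    (Module.Flat.lTensor_preserves_injective_linearMap k hk)
  -- The injective composite `N₁ ⊗ A → N₁ ⊗ F → N₂ ⊗ F` factors through `N₁ ⊗ A → N₂ ⊗ A`, which is
  -- therefore injective.
  have h1 : Function.Injective (f.lTensor N₁) :=
    Module.Flat.lTensor_preserves_injective_linearMap f hf
  have h2 : Function.Injective (i.rTensor F) :=
    Module.Flat.rTensor_preserves_injective_linearMap i hi
  have h3 := h2.comp h1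
  rw [← LinearMap.coe_comp, LinearMap.rTensor_comp_lTensor,
    ← LinearMap.lTensor_comp_rTensor, LinearMap.coe_comp] at h3
  exact h3.of_comp

lemma torVanishes_one_of_right [Module.Flat R F] {f : A →ₗ[R] F} (hf : Function.Injective f)
    (h : projectiveDimension (ModuleCat.of R N) ≤ 1) : TorVanishes R 1 A N := by
  obtain ⟨g, hg⟩ := exists_finsupp_cover R A
  obtain ⟨q, hq⟩ := exists_finsupp_cover R N
  have := (projectiveDimension_le_one_iff_projective (Submodule.subtype_injective _)
    q.exact_subtype_ker_map hq).1 h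
  exact torVanishes_one_of_flat_syzygy hf (Submodule.subtype_injective _)
    g.exact_subtype_ker_map hg (Submodule.subtype_injective _) q.exact_subtype_ker_map hq

lemma torVanishes_add_two_of_right (n : ℕ)
    (h : projectiveDimension (ModuleCat.of R N) ≤ 1) : TorVanishes R (n + 2) C N := by
  induction n generalizing C with
  | zero =>
    obtain ⟨g, hg⟩ := exists_finsupp_cover R C
    exact (torVanishes_add_two_iff (Submodule.subtype_injective _) g.exact_subtype_ker_map
      hg 0).2 (torVanishes_one_of_right (Submodule.subtype_injective _) h)
  | succ n ih =>
    obtain ⟨g, hg⟩ := exists_finsupp_cover R C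
    exact (torVanishes_add_two_iff (Submodule.subtype_injective _) g.exact_subtype_ker_map
      hg (n + 1)).2 ih

end ProjectiveDimensionOne

/-! ### Minimal covers over a local ring -/

section MinimalCover

open IsLocalRing

variable {R : Type u} [CommRing R] [IsLocalRing R]

/-- Take the least possible number of generators: a relation with a unit coordinate would make that
generator redundant. -/
lemma exists_minimal_cover (M : Type v) [AddCommGroup M] [Module R M] [Module.Finite R M] :
    ∃ (n : ℕ) (g : (Fin n → R) →ₗ[R] M), Function.Surjective g ∧
      ∀ x ∈ LinearMap.ker g, ∀ i, x i ∈ maximalIdeal R := by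
  classical
  have hex : ∃ n, ∃ v : Fin n → M, Submodule.span R (Set.range v) = ⊤ :=
    Module.Finite.exists_fin
  obtain ⟨v, hv⟩ := Nat.find_spec hex
  have hmin := fun k => Nat.find_min (m := k) hex
  generalize Nat.find hex = n at v hmin
  refine ⟨n, Fintype.linearCombination R v, ?_, ?_⟩
  · rw [← LinearMap.range_eq_top, Fintype.range_linearCombination, hv]
  · intro x hx i
    by_contra hi
    obtain _ | n := n
    · exact i.elim0
    refine hmin n n.lt_succ_self ⟨v ∘ i.succAbove, ?_⟩
    rw [eq_top_iff, ← hv, Submodule.span_le]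
    rintro _ ⟨j, rfl⟩
    obtain rfl | ⟨j, rfl⟩ := Fin.eq_self_or_eq_succAbove i j
    · obtain ⟨c, hc⟩ := (notMem_maximalIdeal.1 hi).exists_left_inv
      have h0 : ∑ j, x j • v j = 0 := hx
      rw [Fin.sum_univ_succAbove _ j] at h0
      have : v j = -(c • ∑ l, x (j.succAbove l) • v (j.succAbove l)) := by
        rw [← neg_eq_of_add_eq_zero_right h0, smul_neg, neg_neg, smul_smul, hc, one_smul]
      rw [this]
      exact Submodule.neg_mem _ (Submodule.smul_mem _ _ (Submodule.sum_mem _ fun l _ =>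
        Submodule.smul_mem _ _ (Submodule.subset_span ⟨l, rfl⟩)))
    · exact Submodule.subset_span ⟨j, rfl⟩

end MinimalCover

/-! ### A criterion for discrete valuation rings -/

section DVR

open IsLocalRing

/-- By Krull's intersection theorem every nonzero element is a unit times a power of `a`; as `a` is
regular, such products are nonzero. -/
lemma isDVR_of_maximalIdeal_eq_span {S : Type*} [CommRing S] [IsLocalRing S] [IsNoetherianRing S]
    {a : S} (ha : maximalIdeal S = Ideal.span {a}) (hreg : ∀ x, x * a = 0 → x = 0) : IsDVR S := by
  have hpow : ∀ n x, x * a ^ n = 0 → x = 0 := by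
    intro n
    induction n with
    | zero => intro x hx; simpa using hx
    | succ n ih => intro x hx; exact ih x (hreg _ (by rw [mul_assoc, ← pow_succ, hx]))
  have hfac : ∀ x : S, x ≠ 0 → ∃ (n : ℕ) (c : S), IsUnit c ∧ x = c * a ^ n := by
    intro x hx
    have hex : ∃ n, x ∉ maximalIdeal S ^ n := by
      by_contra! h
      refine hx ?_
      rw [← Ideal.mem_bot, ← Ideal.iInf_pow_eq_bot_of_isLocalRing (maximalIdeal S)
        (Ideal.IsMaximal.ne_top inferInstance)]
      exact Ideal.mem_iInf.2 h
    classical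
    obtain ⟨n, hn⟩ : ∃ n, Nat.find hex = n + 1 :=
      Nat.exists_eq_succ_of_ne_zero fun h => by simpa [h] using Nat.find_spec hex
    have h1 := Nat.find_spec hex
    have h2 := not_not.1 (Nat.find_min hex (m := n) (by omega))
    rw [hn] at h1
    rw [ha, Ideal.span_singleton_pow, Ideal.mem_span_singleton'] at h1 h2
    obtain ⟨c, rfl⟩ := h2
    refine ⟨n, c, ?_, rfl⟩
    by_contra hc
    have hc' : c ∈ maximalIdeal S := hc
    rw [ha, Ideal.mem_span_singleton'] at hc'
    obtain ⟨b, rfl⟩ := hc'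
    exact h1 ⟨b, by ring⟩
  have hdom : IsDomain S := by
    have : NoZeroDivisors S := by
      refine ⟨fun {x y} hxy => ?_⟩
      by_contra! h
      obtain ⟨n, c, hc, rfl⟩ := hfac x h.1
      obtain ⟨l, b, hb, rfl⟩ := hfac y h.2
      refine (hc.mul hb).ne_zero (hpow (n + l) _ ?_)
      rw [← hxy]; ring
    exact NoZeroDivisors.to_isDomain S
  have hfield : ¬ IsField S := by
    intro h
    have h0 := (isField_iff_maximalIdeal_eq (R := S)).1 h
    rw [ha, Ideal.span_singleton_eq_bot] at h0
    exact one_ne_zero (hreg 1 (by rw [h0, mul_zero]))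
  have hp : (maximalIdeal S).IsPrincipal := ⟨a, ha⟩
  exact ⟨hdom, ((IsDiscreteValuationRing.TFAE S hfield).out 0 4 :).2 hp⟩

end DVR

/-! ### Balancing `Tor_1`; coordinates in an ideal -/

/-- Balance of `Tor_1`: vanishing is read off a presentation of `A` and moved by a diagram chase to
a presentation of `N`. -/
lemma lTensor_injective_of_torVanishes_of_cover {R : Type u} [CommRing R] {A K G N N₁ N₂ : Type u}
    [AddCommGroup A] [Module R A] [AddCommGroup K] [Module R K] [AddCommGroup G] [Module R G]
    [AddCommGroup N] [Module R N] [AddCommGroup N₁] [Module R N₁] [AddCommGroup N₂] [Module R N₂]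
    [Module.Flat R G] {k : K →ₗ[R] G} {g : G →ₗ[R] A}
    (hT : TorVanishes R 1 A N) (hk : Function.Injective k) (hkg : Function.Exact k g)
    (hg : Function.Surjective g) {i : N₁ →ₗ[R] N₂} {q : N₂ →ₗ[R] N} (hi : Function.Injective i)
    (hiq : Function.Exact i q) (hq : Function.Surjective q) :
    Function.Injective (i.lTensor A) :=
  lTensor_injective_of_exact_of_exact_of_rTensor_injective hkg hg hiq hq
    ((torVanishes_one_iff hk hkg hg).1 hT)
    (Module.Flat.lTensor_preserves_injective_linearMap i hi)

lemma TorVanishes.lTensor_injective {R : Type u} [CommRing R] {A N N₁ N₂ : Type u}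
    [AddCommGroup A] [Module R A] [AddCommGroup N] [Module R N] [AddCommGroup N₁] [Module R N₁]
    [AddCommGroup N₂] [Module R N₂] {i : N₁ →ₗ[R] N₂} {q : N₂ →ₗ[R] N}
    (hT : TorVanishes R 1 A N) (hi : Function.Injective i) (hiq : Function.Exact i q)
    (hq : Function.Surjective q) : Function.Injective (i.lTensor A) := by
  obtain ⟨g, hg⟩ := exists_finsupp_cover R A
  exact lTensor_injective_of_torVanishes_of_cover hT (Submodule.subtype_injective _)
    g.exact_subtype_ker_map hg hi hiq hq

/-- The vectors of `K` with all coordinates in `I`. -/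
abbrev coordPart {R : Type*} [CommRing R] {ι : Type} (I : Ideal R) (K : Submodule R (ι → R)) : Submodule R (ι → R) :=
  K ⊓ Submodule.pi Set.univ fun _ => I

lemma map_mem_smul_top {R : Type*} [CommRing R] {n : ℕ} {W : Type*} [AddCommGroup W] [Module R W] (I : Ideal R)
    (d : (Fin n → R) →ₗ[R] W) {x : Fin n → R} (hx : ∀ i, x i ∈ I) :
    d x ∈ (I • ⊤ : Submodule R W) := by
  rw [LinearMap.pi_apply_eq_sum_univ d x]
  exact Submodule.sum_mem _ fun i _ => Submodule.smul_mem_smul (hx i) trivial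

/-- `I • W` and `J • W` meet in zero. -/
abbrev SmulDisjoint {R : Type*} [CommRing R] (I J : Ideal R) (W : Type*) [AddCommGroup W] [Module R W] : Prop :=
  Disjoint (I • ⊤ : Submodule R W) (J • ⊤ : Submodule R W)

/-! ### Local rings whose maximal ideal splits -/

section SplitMaximalIdeal

open IsLocalRing

variable {R : Type u} [CommRing R] [IsLocalRing R]

/-- The maximal ideal is the internal direct sum of the nonzero ideals `I` and `J`. -/
structure MaximalIdealSplits (I J : Ideal R) : Prop where
  inf_eq_bot : I ⊓ J = ⊥
  sup_eq : I ⊔ J = maximalIdeal R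
  left_ne_bot : I ≠ ⊥
  right_ne_bot : J ≠ ⊥

namespace MaximalIdealSplits

variable {I J : Ideal R}

lemma symm (h : MaximalIdealSplits I J) : MaximalIdealSplits J I :=
  ⟨by rw [inf_comm, h.inf_eq_bot], by rw [sup_comm, h.sup_eq], h.right_ne_bot, h.left_ne_bot⟩

lemma left_le (h : MaximalIdealSplits I J) : I ≤ maximalIdeal R := h.sup_eq ▸ le_sup_left

lemma right_le (h : MaximalIdealSplits I J) : J ≤ maximalIdeal R := h.sup_eq ▸ le_sup_right

lemma eq_zero (h : MaximalIdealSplits I J) {x : R} (hI : x ∈ I) (hJ : x ∈ J) : x = 0 := by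
  have : x ∈ I ⊓ J := ⟨hI, hJ⟩
  rwa [h.inf_eq_bot, Ideal.mem_bot] at this

lemma mul_eq_zero (h : MaximalIdealSplits I J) {x y : R} (hx : x ∈ I) (hy : y ∈ J) : x * y = 0 :=
  h.eq_zero (I.mul_mem_right _ hx) (J.mul_mem_left _ hy)

lemma exists_proj (h : MaximalIdealSplits I J) :
    ∃ p : maximalIdeal R →ₗ[R] R, (∀ x, p x ∈ I) ∧ ∀ x : maximalIdeal R, (x : R) - p x ∈ J := by
  let m := maximalIdeal R
  have hc : IsCompl (Submodule.comap m.subtype I) (Submodule.comap m.subtype J) := by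
    constructor
    · rw [disjoint_iff, eq_bot_iff]
      rintro x ⟨hI, hJ⟩
      exact Subtype.ext (h.eq_zero hI hJ)
    · rw [codisjoint_iff, eq_top_iff]
      rintro ⟨x, hx⟩ -
      obtain ⟨y, hy, z, hz, rfl⟩ := Submodule.mem_sup.1 (h.sup_eq.ge hx)
      exact Submodule.mem_sup.2 ⟨⟨y, h.left_le hy⟩, hy, ⟨z, h.right_le hz⟩, hz, rfl⟩
  refine ⟨m.subtype ∘ₗ Submodule.projection _ _ hc, fun x => ?_, fun x => ?_⟩
  · exact Submodule.projection_apply_mem hc x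
  · have := Submodule.projection_add_projection_eq_self hc x
    have h2 : x - Submodule.projection _ _ hc x = Submodule.projection _ _ hc.symm x := by
      rw [sub_eq_iff_eq_add, add_comm, this]
    have h3 := Submodule.projection_apply_mem hc.symm x
    rw [← h2] at h3
    exact h3

lemma proj_of_mem_left (h : MaximalIdealSplits I J) {p : maximalIdeal R →ₗ[R] R}
    (hp : ∀ x, p x ∈ I) (hq : ∀ x : maximalIdeal R, (x : R) - p x ∈ J) {x : maximalIdeal R} (hx : (x : R) ∈ I) :
    p x = x :=
  (sub_eq_zero.1 (h.eq_zero (I.sub_mem hx (hp x)) (hq x))).symm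

lemma proj_of_mem_right (h : MaximalIdealSplits I J) {p : maximalIdeal R →ₗ[R] R}
    (hp : ∀ x, p x ∈ I) (hq : ∀ x : maximalIdeal R, (x : R) - p x ∈ J) {x : maximalIdeal R} (hx : (x : R) ∈ J) :
    p x = 0 :=
  h.eq_zero (hp x) (by simpa using J.sub_mem hx (hq x))

end MaximalIdealSplits

namespace MaximalIdealSplits

variable {I J : Ideal R} {N : Type u} [AddCommGroup N] [Module R N]

lemma smulDisjoint_self (h : MaximalIdealSplits I J) : SmulDisjoint I J R := by
  rw [SmulDisjoint, disjoint_iff]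
  simpa using h.inf_eq_bot

lemma smulDisjoint_pi (h : MaximalIdealSplits I J) (ι : Type*) : SmulDisjoint I J (ι → R) := by
  have hle : ∀ K : Ideal R, (K • ⊤ : Submodule R (ι → R)) ≤ Submodule.pi Set.univ fun _ => K :=
    fun K => Submodule.smul_le.2 fun r hr x _ i _ => K.mul_mem_right _ hr
  rw [SmulDisjoint, Submodule.disjoint_def]
  intro x hI hJ
  ext i
  exact h.eq_zero (hle I hI i trivial) (hle J hJ i trivial)

section Syzygy

variable {n : ℕ} {W : Type*} [AddCommGroup W] [Module R W] {d : (Fin n → R) →ₗ[R] W}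

/-- Let `P x` be the coordinatewise projection of `x` to `I`. If `d x = 0`, then `d (P x) = -d (x -
P x)` lies in both `I • W` and `J • W`, so it is zero and `P x` is again in the kernel. -/
lemma exists_retraction (h : MaximalIdealSplits I J) (hW : SmulDisjoint I J W)
    (hd : ∀ x ∈ LinearMap.ker d, ∀ i, x i ∈ maximalIdeal R) :
    ∃ r : LinearMap.ker d →ₗ[R] ↥(coordPart I (LinearMap.ker d)),
      (∀ (x : LinearMap.ker d) (i : Fin n), (x : Fin n → R) i - (r x : Fin n → R) i ∈ J) ∧
      r ∘ₗ Submodule.inclusion inf_le_left = LinearMap.id := by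
  obtain ⟨p, hp, hq⟩ := h.exists_proj
  let P : LinearMap.ker d →ₗ[R] (Fin n → R) :=
    { toFun := fun x i => p ⟨x.1 i, hd x.1 x.2 i⟩
      map_add' := fun x y => funext fun i =>
        p.map_add ⟨x.1 i, hd x.1 x.2 i⟩ ⟨y.1 i, hd y.1 y.2 i⟩
      map_smul' := fun c x => funext fun i => p.map_smul c ⟨x.1 i, hd x.1 x.2 i⟩ }
  have hP : ∀ x, P x ∈ coordPart I (LinearMap.ker d) := by
    intro x
    have h1 : d (P x) ∈ (I • ⊤ : Submodule R W) := map_mem_smul_top I d fun i => hp _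
    have h2 : d (x.1 - P x) ∈ (J • ⊤ : Submodule R W) := 
      map_mem_smul_top J d fun i => hq ⟨x.1 i, hd x.1 x.2 i⟩
    rw [map_sub, LinearMap.mem_ker.1 x.2, zero_sub, Submodule.neg_mem_iff] at h2
    exact ⟨Submodule.disjoint_def.1 hW _ h1 h2, fun i _ => hp _⟩
  refine ⟨P.codRestrict _ hP, fun x i => hq ⟨x.1 i, hd x.1 x.2 i⟩, ?_⟩
  ext x i
  exact h.proj_of_mem_left hp hq (x := ⟨x.1 i, hd x.1 x.2.1 i⟩) (x.2.2 i trivial)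

lemma torVanishes_coordPart {k : ℕ} (h : MaximalIdealSplits I J) (hW : SmulDisjoint I J W)
    (hd : ∀ x ∈ LinearMap.ker d, ∀ i, x i ∈ maximalIdeal R)
    (hT : TorVanishes R k (LinearMap.ker d) N) :
    TorVanishes R k ↥(coordPart I (LinearMap.ker d)) N := by
  obtain ⟨r, -, hr⟩ := h.exists_retraction hW hd
  exact hT.of_retract _ r hr

lemma ker_eq_bot (h : MaximalIdealSplits I J) (hW : SmulDisjoint I J W)
    (hd : ∀ x ∈ LinearMap.ker d, ∀ i, x i ∈ maximalIdeal R)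
    (hI : coordPart I (LinearMap.ker d) = ⊥) (hJ : coordPart J (LinearMap.ker d) = ⊥) :
    LinearMap.ker d = ⊥ := by
  obtain ⟨r, hr, -⟩ := h.exists_retraction hW hd
  rw [eq_bot_iff]
  intro x hx
  rw [← hJ]
  refine ⟨hx, fun i _ => ?_⟩
  have h0 : (r ⟨x, hx⟩ : Fin n → R) = 0 :=
    (Submodule.mem_bot R).1 (hI.le (r ⟨x, hx⟩).2)
  simpa [h0] using hr ⟨x, hx⟩ i

lemma smul_coordPart (h : MaximalIdealSplits I J) (K : Submodule R (Fin n → R)) :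
    ∀ j ∈ J, ∀ x : ↥(coordPart I K), j • x = 0 := by
  intro j hj x
  ext i
  exact h.symm.mul_eq_zero hj (x.2.2 i trivial)

end Syzygy

/-- In a minimal cover of `X` by a free module, `J` times a basis vector lies in the kernel. By
minimality that coordinate maps the kernel to the maximal ideal, and projecting on to `J` splits the
inclusion. -/
lemma torVanishes_of_smul_eq_zero (h : MaximalIdealSplits I J) {X : Type u} [AddCommGroup X]
    [Module R X] [Module.Finite R X] [Nontrivial X] (hX : ∀ j ∈ J, ∀ x : X, j • x = 0) {k : ℕ}
    (hT : TorVanishes R (k + 2) X N) : TorVanishes R (k + 1) J N := by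
  obtain ⟨n, g, hg, hmin⟩ := exists_minimal_cover (R := R) X
  obtain ⟨p, hp, hq⟩ := h.exists_proj
  have hne : Nonempty (Fin n) := by
    by_contra hn
    rw [not_nonempty_iff] at hn
    exact not_subsingleton X hg.subsingleton
  obtain ⟨i⟩ := hne
  let s : J →ₗ[R] LinearMap.ker g :=
    (LinearMap.single R (fun _ => R) i ∘ₗ J.subtype).codRestrict _ fun j => by
      have : (Pi.single i (j : R) : Fin n → R) = (j : R) • Pi.single i 1 := by
        rw [← Pi.single_smul, smul_eq_mul, mul_one]
      change g (Pi.single i (j : R)) = 0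
      rw [this, map_smul, hX _ j.2]
  let c : LinearMap.ker g →ₗ[R] maximalIdeal R :=
    (LinearMap.proj i ∘ₗ (LinearMap.ker g).subtype).codRestrict _ fun x => hmin x.1 x.2 i
  let q : maximalIdeal R →ₗ[R] J := ((maximalIdeal R).subtype - p).codRestrict _ hq
  refine ((torVanishes_add_two_iff (Submodule.subtype_injective _) g.exact_subtype_ker_map
    hg k).1 hT).of_retract s (q ∘ₗ c) ?_
  ext j
  have hc : c (s j) = ⟨j, h.right_le j.2⟩ := Subtype.ext (Pi.single_eq_same (M := fun _ => R) i (j : R))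
  change (c (s j) : R) - p (c (s j)) = j
  rw [hc, h.proj_of_mem_right hp hq j.2, sub_zero]

/-- Every minimal syzygy of `I` has a nonzero vector with coordinates in `I`: the ideal `I` is not
free over `R ⧸ J`. -/
def _root_.NotFreeModuloComplement (I : Ideal R) : Prop :=
  ∀ (n : ℕ) (d : (Fin n → R) →ₗ[R] R), LinearMap.range d = I →
    (∀ x ∈ LinearMap.ker d, ∀ i, x i ∈ maximalIdeal R) → coordPart I (LinearMap.ker d) ≠ ⊥

lemma lTensor_maximalIdeal_injective (h : MaximalIdealSplits I J) {A B : Type*} [AddCommGroup A]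
    [Module R A] [AddCommGroup B] [Module R B] {f : A →ₗ[R] B}
    (hI : Function.Injective (f.lTensor I)) (hJ : Function.Injective (f.lTensor J)) :
    Function.Injective (f.lTensor (maximalIdeal R)) := by
  obtain ⟨p, hp, hq⟩ := h.exists_proj
  let p' : maximalIdeal R →ₗ[R] I := p.codRestrict _ hp
  let q' : maximalIdeal R →ₗ[R] J := ((maximalIdeal R).subtype - p).codRestrict _ hq
  have hid : Submodule.inclusion h.left_le ∘ₗ p' + Submodule.inclusion h.right_le ∘ₗ q' =
      LinearMap.id := by
    ext x
    change p x + (x - p x) = x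
    ring
  rw [injective_iff_map_eq_zero]
  intro x hx
  have key : ∀ {K : Ideal R} (c : maximalIdeal R →ₗ[R] K), Function.Injective (f.lTensor K) →
      c.rTensor A x = 0 := by
    intro K c hK
    apply hK
    rw [← LinearMap.comp_apply, LinearMap.lTensor_comp_rTensor, ← LinearMap.rTensor_comp_lTensor,
      LinearMap.comp_apply, hx, map_zero, map_zero]
  have := congrArg (fun l => l.rTensor A x) hid
  simpa [LinearMap.rTensor_add, LinearMap.rTensor_comp, key p' hI, key q' hJ, eq_comm] using this

variable [IsNoetherianRing R]

lemma torVanishes_of_coordPart_ne_bot {n : ℕ} {W : Type*} [AddCommGroup W] [Module R W]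
    {d : (Fin n → R) →ₗ[R] W} {k : ℕ} (h : MaximalIdealSplits I J) (hW : SmulDisjoint I J W)
    (hd : ∀ x ∈ LinearMap.ker d, ∀ i, x i ∈ maximalIdeal R)
    (hne : coordPart I (LinearMap.ker d) ≠ ⊥)
    (hT : TorVanishes R (k + 2) (LinearMap.ker d) N) : TorVanishes R (k + 1) J N :=
  have := Submodule.nontrivial_iff_ne_bot.2 hne
  h.torVanishes_of_smul_eq_zero (X := ↥(coordPart I (LinearMap.ker d)))
    (h.smul_coordPart (LinearMap.ker d)) (h.torVanishes_coordPart hW hd hT)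

lemma torVanishes_swap (h : MaximalIdealSplits I J) {k : ℕ} (hT : TorVanishes R (k + 2) I N) :
    TorVanishes R (k + 1) J N :=
  have := Submodule.nontrivial_iff_ne_bot.2 h.left_ne_bot
  h.torVanishes_of_smul_eq_zero
    (fun _ hj x => Subtype.ext (h.symm.mul_eq_zero hj x.2)) hT

/-- The syzygy of `I` has a nonzero summand with coordinates in `I`, hence killed by `J`; its own
syzygy contains `J`. Two applications of `torVanishes_swap` would return to `I` instead. -/
lemma torVanishes_swap_twice (h : MaximalIdealSplits I J) (hI : NotFreeModuloComplement I) {k : ℕ}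
    (hT : TorVanishes R (k + 3) I N) : TorVanishes R (k + 1) J N := by
  obtain ⟨n, g, hg, hmin⟩ := exists_minimal_cover (R := R) I
  have hker : LinearMap.ker (I.subtype ∘ₗ g) = LinearMap.ker g :=
    LinearMap.ker_comp_of_ker_eq_bot _ (Submodule.ker_subtype _)
  have hrange : LinearMap.range (I.subtype ∘ₗ g) = I := by
    rw [LinearMap.range_comp, LinearMap.range_eq_top.2 hg, Submodule.map_top,
      Submodule.range_subtype]
  have h1 := (torVanishes_add_two_iff (Submodule.subtype_injective _) g.exact_subtype_ker_map
    hg (k + 1)).1 hT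
  rw [← hker] at hmin h1
  exact h.torVanishes_of_coordPart_ne_bot h.smulDisjoint_self hmin (hI n _ hrange hmin) h1

/-- Swaps lower the degree to 3. From there two swaps return to the same ideal in degree 1, while
`torVanishes_swap_twice` reaches the other one. -/
lemma torVanishes_one_one (h : MaximalIdealSplits I J) (hI : NotFreeModuloComplement I)
    (hJ : NotFreeModuloComplement J) {k : ℕ} (hT : TorVanishes R (k + 3) J N) :
    TorVanishes R 1 I N ∧ TorVanishes R 1 J N := by
  induction k generalizing I J with
  | zero =>
    exact ⟨h.symm.torVanishes_swap_twice hJ hT, h.torVanishes_swap (h.symm.torVanishes_swap hT)⟩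
  | succ k ih => exact (ih h.symm hJ hI (h.symm.torVanishes_swap hT)).symm

/-- The syzygy of a module which embeds into `W` without being projective has a nonzero direct
summand killed by `I` or by `J`. -/
lemma torVanishes_of_not_projective (h : MaximalIdealSplits I J) {A : Type u} [AddCommGroup A]
    [Module R A] [Module.Finite R A] {W : Type*} [AddCommGroup W] [Module R W]
    (hW : SmulDisjoint I J W) {f : A →ₗ[R] W} (hf : Function.Injective f)
    (hA : ¬ Module.Projective R A) {k : ℕ} (hT : TorVanishes R (k + 3) A N) :
    TorVanishes R (k + 1) I N ∨ TorVanishes R (k + 1) J N := by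
  obtain ⟨n, g, hg, hmin⟩ := exists_minimal_cover (R := R) A
  have hker : LinearMap.ker (f ∘ₗ g) = LinearMap.ker g :=
    LinearMap.ker_comp_of_ker_eq_bot _ (LinearMap.ker_eq_bot.2 hf)
  have h2 := (torVanishes_add_two_iff (Submodule.subtype_injective _) g.exact_subtype_ker_map
    hg (k + 1)).1 hT
  have hne : LinearMap.ker g ≠ ⊥ := fun h0 => hA
    (Module.Projective.of_equiv (LinearEquiv.ofBijective g ⟨LinearMap.ker_eq_bot.1 h0, hg⟩))
  rw [← hker] at hmin h2 hne
  by_cases hI : coordPart I (LinearMap.ker (f ∘ₗ g)) = ⊥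
  · exact Or.inl (h.symm.torVanishes_of_coordPart_ne_bot hW.symm hmin
      (fun hJ => hne (h.ker_eq_bot hW hmin hI hJ)) h2)
  · exact Or.inr (h.torVanishes_of_coordPart_ne_bot hW hmin hI h2)

lemma torVanishes_of_not_projectiveDimension_le_one (h : MaximalIdealSplits I J)
    {M : Type u} [AddCommGroup M] [Module R M] [Module.Finite R M]
    (hM : ¬ projectiveDimension (ModuleCat.of R M) ≤ 1) {k : ℕ}
    (hT : TorVanishes R (k + 4) M N) : TorVanishes R (k + 1) I N ∨ TorVanishes R (k + 1) J N := by
  obtain ⟨n, g, hg⟩ := Module.Finite.exists_fin' R M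
  rw [projectiveDimension_le_one_iff_projective (Submodule.subtype_injective _)
    g.exact_subtype_ker_map hg] at hM
  exact h.torVanishes_of_not_projective (h.smulDisjoint_pi (Fin n)) (Submodule.subtype_injective _)
    hM ((torVanishes_add_two_iff (Submodule.subtype_injective _) g.exact_subtype_ker_map
      hg (k + 2)).1 hT)

/-- For a first syzygy `K ⊆ R^n` of `N`, the map `𝔪 ⊗ K → 𝔪 ⊗ R^n → R ⊗ R^n` is injective and
factors through `R ⊗ K`. So `𝔪 ⊗ K → R ⊗ K` is injective, and `K` is free by the local criterion. -/
lemma projectiveDimension_le_one (h : MaximalIdealSplits I J) [Module.Finite R N]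
    (hI : TorVanishes R 1 I N) (hJ : TorVanishes R 1 J N) :
    projectiveDimension (ModuleCat.of R N) ≤ 1 := by
  obtain ⟨n, g, hg⟩ := Module.Finite.exists_fin' R N
  have key : ∀ K : Ideal R, TorVanishes R 1 K N →
      Function.Injective ((LinearMap.ker g).subtype.lTensor K) := fun K hK =>
    hK.lTensor_injective (Submodule.subtype_injective _) g.exact_subtype_ker_map hg
  have hm := h.lTensor_maximalIdeal_injective (key I hI) (key J hJ)
  have h1 : Function.Injective ((maximalIdeal R).subtype.rTensor (Fin n → R)) :=
    Module.Flat.rTensor_preserves_injective_linearMap _ (Submodule.subtype_injective _)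
  have h2 := h1.comp hm
  rw [← LinearMap.coe_comp, LinearMap.rTensor_comp_lTensor,
    ← LinearMap.lTensor_comp_rTensor, LinearMap.coe_comp] at h2
  have := Module.finitePresentation_of_finite R (LinearMap.ker g)
  have := Module.free_of_maximalIdeal_rTensor_injective h2.of_comp
  exact (projectiveDimension_le_one_iff_projective (Submodule.subtype_injective _)
    g.exact_subtype_ker_map hg).2 inferInstance

lemma projectiveDimension_le_one_or (h : MaximalIdealSplits I J) (hI : NotFreeModuloComplement I)
    (hJ : NotFreeModuloComplement J) {M : Type u} [AddCommGroup M] [Module R M]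
    [Module.Finite R M] [Module.Finite R N] {k : ℕ} (hT : TorVanishes R (k + 6) M N) :
    projectiveDimension (ModuleCat.of R M) ≤ 1 ∨ projectiveDimension (ModuleCat.of R N) ≤ 1 := by
  by_cases hM : projectiveDimension (ModuleCat.of R M) ≤ 1
  · exact Or.inl hM
  -- Three degrees are spent on reaching `I` or `J`; degree `k + 3` remains, as
  -- `torVanishes_one_one` requires.
  · obtain hT | hT := h.torVanishes_of_not_projectiveDimension_le_one (k := k + 2) hM hT
    · obtain ⟨h1, h2⟩ := h.symm.torVanishes_one_one hJ hI hT
      exact Or.inr (h.projectiveDimension_le_one h2 h1)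
    · obtain ⟨h1, h2⟩ := h.torVanishes_one_one hI hJ hT
      exact Or.inr (h.projectiveDimension_le_one h1 h2)

end MaximalIdealSplits

end SplitMaximalIdeal

/-! ### The fiber product ring -/

section FiberProduct

open IsLocalRing

/-- Otherwise `I` would be generated by one element `a` whose annihilator lies in `J`. Then `φ a`
would be a regular generator of the maximal ideal of `S`, making `S` a DVR. -/
lemma MaximalIdealSplits.notFreeModuloComplement {R : Type u} [CommRing R] [IsLocalRing R]
    {I J : Ideal R} (h : MaximalIdealSplits I J) {S : Type*} [CommRing S] [IsLocalRing S]
    [IsNoetherianRing S] {φ : R →+* S} (hφ : Function.Surjective φ) (hker : RingHom.ker φ = J)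
    (hS : ¬ IsDVR S) : NotFreeModuloComplement I := by
  intro n d hd hmin hbot
  have hzero : ∀ x : Fin n → R, d x = 0 → (∀ i, x i ∈ I) → x = 0 := fun x hx hI => by
    rw [← Submodule.mem_bot R, ← hbot]
    exact ⟨hx, fun i _ => hI i⟩
  have hmem : ∀ x, d x ∈ I := fun x => hd ▸ LinearMap.mem_range_self d x
  have hsingle : ∀ (i : Fin n) (r : R), d (Pi.single i r) = r * d (Pi.single i 1) := fun i r => by
    rw [← smul_eq_mul, ← map_smul, ← Pi.single_smul, smul_eq_mul, mul_one]
  have hne : ∀ i, d (Pi.single i 1) ≠ 0 := fun i hi => by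
    have := hmin _ hi i
    rw [Pi.single_eq_same] at this
    exact (Ideal.ne_top_iff_one _).1 (Ideal.IsMaximal.ne_top inferInstance) this
  have hsub : ∀ i j : Fin n, i = j := by
    intro i j
    by_contra hij
    -- The Koszul relation between two generators has coordinates in `I`, so it must vanish; this
    -- rules out a second generator.
    have h0 := hzero (Pi.single i (d (Pi.single j 1)) - Pi.single j (d (Pi.single i 1)))
      (by rw [map_sub, hsingle i (d _), hsingle j (d _), mul_comm, sub_self])
      (fun l => I.sub_mem
        (by by_cases hl : l = i <;> [(subst hl; simpa using hmem _); simp [hl]])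
        (by by_cases hl : l = j <;> [(subst hl; simpa using hmem _); simp [hl]]))
    have := congrFun h0 i
    simp [hij] at this
    exact hne j this
  have hn : Nonempty (Fin n) := by
    by_contra hn
    rw [not_nonempty_iff] at hn
    apply h.left_ne_bot
    rw [← hd, LinearMap.range_eq_bot]
    exact LinearMap.ext fun x => by rw [Subsingleton.elim x 0, map_zero, map_zero]
  obtain ⟨i⟩ := hn
  have hx : ∀ x : Fin n → R, x = Pi.single i (x i) := fun x => by
    ext j; rw [hsub j i, Pi.single_eq_same]
  set a := d (Pi.single i 1) with ha
  have hI : I = Ideal.span {a} := by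
    ext y
    rw [Ideal.mem_span_singleton', ← hd]
    exact ⟨fun ⟨x, hxy⟩ => ⟨x i, by rw [← hsingle, ← hx, hxy]⟩,
      fun ⟨r, hr⟩ => ⟨Pi.single i r, by rw [hsingle, hr]⟩⟩
  have hann : ∀ x, x * a = 0 → x ∈ J := by
    intro x hxa
    have h0 : d (Pi.single i x) = 0 := by rw [hsingle, hxa]
    have hxm := hmin _ h0 i
    rw [Pi.single_eq_same, ← h.sup_eq] at hxm
    -- Split the annihilating element along `I ⊕ J`: the `J`-part kills `a` anyway, so the `I`-part
    -- is a relation with coordinate in `I` and vanishes.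
    obtain ⟨y, hy, z, hz, rfl⟩ := Submodule.mem_sup.1 hxm
    have hya : y * a = 0 := by
      rw [add_mul, mul_comm z, h.mul_eq_zero (hmem _) hz, add_zero] at hxa
      exact hxa
    have := congrFun (hzero (Pi.single i y) (by rw [hsingle, hya]) fun j => by
      rw [hsub j i, Pi.single_eq_same]; exact hy) i
    rw [Pi.single_eq_same] at this
    rw [this, Pi.zero_apply, zero_add]
    exact hz
  have hloc : IsLocalHom φ := hφ.isLocalHom
  refine hS (isDVR_of_maximalIdeal_eq_span (a := φ a) ?_ ?_)
  · have hJ : J.map φ = ⊥ := (Ideal.map_eq_bot_iff_le_ker φ).2 hker.ge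
    rw [← Set.image_singleton, ← Ideal.map_span, ← hI]
    rw [← map_maximalIdeal_of_surjective φ hφ, ← h.sup_eq, Ideal.map_sup, hJ, sup_bot_eq]
  · intro s hs
    obtain ⟨x, rfl⟩ := hφ s
    rw [← map_mul, ← RingHom.mem_ker, hker] at hs
    have := hann x (h.eq_zero (I.mul_mem_left _ (hmem _)) hs)
    rwa [← hker] at this

lemma isNoetherian_of_algebraMap_surjective {A B : Type*} [CommRing A] [CommRing B] [Algebra A B]
    [IsNoetherianRing B] (h : Function.Surjective (algebraMap A B)) : IsNoetherian A B where
  noetherian N := by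
    let N' : Submodule B B :=
      { N with
        smul_mem' := fun b x hx => by
          obtain ⟨a, rfl⟩ := h b
          rw [algebraMap_smul]
          exact N.smul_mem a hx }
    exact Submodule.FG.restrictScalars_of_surjective (S := N') (IsNoetherian.noetherian N') h

variable {S : Type u} {T : Type v} {k : Type w} [CommRing S] [CommRing T] [Field k]
  {πS : S →+* k} {πT : T →+* k}

/-- `R` embeds as an `R`-module in `S × T`, whose factors are Noetherian over `R` because they are
quotients of `R`. -/
lemma isNoetherianRing_pullback [IsNoetherianRing S] [IsNoetherianRing T]
    (hπS : Function.Surjective πS) (hπT : Function.Surjective πT) :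
    IsNoetherianRing (πS.pullback πT) := by
  let φ := πS.pullbackFst πT
  let ψ := πS.pullbackSnd πT
  let := φ.toAlgebra
  let := ψ.toAlgebra
  have hφ : Function.Surjective (algebraMap (πS.pullback πT) S) :=
    RingHom.surjective_pullbackFst_of_surjective πS πT hπT
  have hψ : Function.Surjective (algebraMap (πS.pullback πT) T) :=
    RingHom.surjective_pullbackSnd_of_surjective πS πT hπS
  have := isNoetherian_of_algebraMap_surjective hφ
  have := isNoetherian_of_algebraMap_surjective hψ
  exact isNoetherian_of_injective
    ((Algebra.linearMap (πS.pullback πT) S).prod (Algebra.linearMap (πS.pullback πT) T))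
    (fun x y hxy => Subtype.ext hxy)

lemma maximalIdealSplits_pullback [IsLocalRing S] [IsLocalRing T] [IsLocalRing (πS.pullback πT)]
    (hπS : Function.Surjective πS) (hπT : Function.Surjective πT)
    (hS : ¬ IsField S) (hT : ¬ IsField T) :
    MaximalIdealSplits (RingHom.ker (πS.pullbackSnd πT)) (RingHom.ker (πS.pullbackFst πT)) where
  inf_eq_bot := by
    rw [eq_bot_iff]
    rintro ⟨⟨s, t⟩, h⟩ ⟨h1, h2⟩
    exact Subtype.ext (Prod.ext h2 h1)
  sup_eq := by
    have := hπS.isLocalHom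
    have := hπT.isLocalHom
    apply le_antisymm
    · exact sup_le (le_maximalIdeal (RingHom.ker_ne_top _)) (le_maximalIdeal (RingHom.ker_ne_top _))
    · rintro ⟨⟨s, t⟩, h⟩ hx
      have hst : πS s = πT t := h
      have hs : πS s = 0 := by
        by_contra h0
        have h1 : IsUnit s := isUnit_of_map_unit πS s (IsUnit.mk0 _ h0)
        have h2 : IsUnit t := isUnit_of_map_unit πT t (IsUnit.mk0 _ (hst ▸ h0))
        exact hx ((RingHom.isUnit_pullback_mk_iff πS πT h).2 ⟨h1, h2⟩)
      refine Submodule.mem_sup.2 ⟨⟨(s, 0), ?_⟩, rfl, ⟨(0, t), ?_⟩, rfl, ?_⟩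
      · change πS s = πT 0
        rw [hs, map_zero]
      · change πS 0 = πT t
        rw [← hst, hs, map_zero]
      · exact Subtype.ext (Prod.ext (add_zero s) (zero_add t))
  left_ne_bot := by
    have hne := isField_iff_maximalIdeal_eq.not.1 hS
    obtain ⟨s, hs, hs0⟩ := Submodule.exists_mem_ne_zero_of_ne_bot hne
    rw [← ker_eq_maximalIdeal πS hπS] at hs
    intro h0
    have hm : (⟨(s, 0), by simpa using hs⟩ : πS.pullback πT) ∈
      RingHom.ker (πS.pullbackSnd πT) := rfl
    rw [h0, Ideal.mem_bot] at hm
    exact hs0 (congrArg (fun x : πS.pullback πT => x.1.1) hm)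
  right_ne_bot := by
    have hne := isField_iff_maximalIdeal_eq.not.1 hT
    obtain ⟨t, ht, ht0⟩ := Submodule.exists_mem_ne_zero_of_ne_bot hne
    rw [← ker_eq_maximalIdeal πT hπT] at ht
    intro h0
    have hm : (⟨(0, t), by simpa [eq_comm] using ht⟩ : πS.pullback πT) ∈
      RingHom.ker (πS.pullbackFst πT) := rfl
    rw [h0, Ideal.mem_bot] at hm
    exact ht0 (congrArg (fun x : πS.pullback πT => x.1.2) hm)

end FiberProduct

theorem mainTheorem2
    {S : Type u} {T : Type v} {k : Type w} [CommRing S] [CommRing T] [Field k]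
    [IsLocalRing S] [IsNoetherianRing S] [IsLocalRing T] [IsNoetherianRing T]
    (πS : S →+* k) (πT : T →+* k)
    (hπS : Function.Surjective πS) (hπT : Function.Surjective πT)
    (hS : ¬ IsField S) (hT : ¬ IsField T)
    (hSdvr : ¬ IsDVR S) (hTdvr : ¬ IsDVR T)
    (M N : Type (max u v)) [AddCommGroup M] [AddCommGroup N]
    [Module (πS.pullback πT) M] [Module (πS.pullback πT) N]
    [Module.Finite (πS.pullback πT) M] [Module.Finite (πS.pullback πT) N]
    (m : ℕ) (hm : 6 ≤ m)
    (hTor : IsZero (((Tor (ModuleCat (πS.pullback πT)) m).obj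
      (ModuleCat.of (πS.pullback πT) M)).obj (ModuleCat.of (πS.pullback πT) N))) :
    (projectiveDimension (ModuleCat.of (πS.pullback πT) M) ≤ 1 ∨
      projectiveDimension (ModuleCat.of (πS.pullback πT) N) ≤ 1) ∧
    ∀ i : ℕ, 2 ≤ i → IsZero (((Tor (ModuleCat (πS.pullback πT)) i).obj
      (ModuleCat.of (πS.pullback πT) M)).obj (ModuleCat.of (πS.pullback πT) N)) := by
  have : IsLocalHom πT := hπT.isLocalHom
  have : IsLocalRing (πS.pullback πT) := RingHom.isLocalRing_pullback πS πT
  have : IsNoetherianRing (πS.pullback πT) := isNoetherianRing_pullback hπS hπT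
  have h := maximalIdealSplits_pullback hπS hπT hS hT
  have hI := h.notFreeModuloComplement
    (RingHom.surjective_pullbackFst_of_surjective πS πT hπT) rfl hSdvr
  have hJ := h.symm.notFreeModuloComplement
    (RingHom.surjective_pullbackSnd_of_surjective πS πT hπS) rfl hTdvr
  obtain ⟨l, rfl⟩ := Nat.exists_eq_add_of_le' hm
  have hpd := h.projectiveDimension_le_one_or hI hJ (M := M) (N := N) (k := l) hTor
  refine ⟨hpd, fun i hi => ?_⟩
  obtain ⟨j, rfl⟩ := Nat.exists_eq_add_of_le' hi
  exact hpd.elim (torVanishes_add_two_of_left j) (torVanishes_add_two_of_right j)
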